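/- **Setting.** A RASPL-1 program is a finite set of rules, each of the form $$a_1 \mid \dots \mid a_l \leftarrow \mathit{Body}\quad (l\ge 0)\qquad\text{or}\qquad \{a_1\}\leftarrow \mathit{Body},$$ where the $a_i$ are first-order atoms (equalities $t_1=t_2$ allowed) and $\mathit{Body}$ is $e_1,\dots,e_m,\mathit{not}\ e_{m+1},\dots,\mathit{not}\ e_n$, each $e_i$ being an atom or an aggregate $b\le\#\mathit{count}\{\mathbf x: L_1,\dots,L_k\}$ ($b,k\ge1$, $\mathbf x$ a list of variables, each $L_i$ an atom possibly preceded by $\mathit{not}$). The FOL representation of such an aggregate is $\exists \mathbf x^1\cdots\mathbf x^b\,[\bigwedge_{i}(L_1\wedge\dots\wedge L_k)(\mathbf x^i)\wedge\bigwedge_{i<j}\neg(\mathbf x^i=\mathbf x^j)]$ with new variables; that of the two kinds of rules is $\widetilde\forall(\mathit{Body}\to a_1\vee\dots\vee a_l)$ and $\widetilde\forall(\neg\neg a_1\wedge\mathit{Body}\to a_1)$ (comma is $\wedge$, $\mathit{not}$ is $\neg$, $\neg F$ is $F\to\bot$, the empty disjunction is $\bot$); that of a program $\Pi$ is the conjunction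 $F_\Pi$ of those of its rules. For a first-order sentence $F$ and a tuple $\mathbf p$ of predicate constants (not including equality), $\mathrm{SM}_{\mathbf p}[F]$ is $F\wedge\neg\exists\mathbf u\,((\mathbf u<\mathbf p)\wedge F^*(\mathbf u))$, where $\mathbf u$ is a tuple of predicate variables corresponding to $\mathbf p$; $\mathbf u<\mathbf p$ says that each $u_i$ is included in $p_i$ and at least one inclusion is strict; and $F^*$ replaces each $p_i$ by $u_i$ in atoms, leaves other atoms, equalities and $\bot$ unchanged, commutes with $\wedge,\vee,\forall,\exists$, and $(F\to G)^*=(F^*\to G^*)\wedge(F\to G)$. If $\Pi$ contains at least one object constant, an answer set of $\Pi$ is an Herbrand interpretation of the signature of $F_\Pi$ (the function and predicate constants that occur in it), identified with the set of its true ground atoms, that satisfies $\mathrm{SM}_{\mathbf p}[F_\Pi]$, where $\mathbf p$ consists of all predicate constants occurring in $F_\Pi$. The dependency graph of $\Pi$ has these predicate constants as vertices, and an edge from $p$ to $q$ if for some strictly positive occurrence of an implication $G\to H$ in $F_\Pi$ the constant $p$ has a strictly positive occurrence in $H$ and $q$ has a positive nonnegated occurrence in $G$. (An occurrence is positive if the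 number of implications containing it in the antecedent is even, strictly positive if that number is $0$, and nonnegated if it lies in no subformula of the form $K\to\bot$.) Let $R$ be a rule $a_1\mid\dots\mid a_l\leftarrow\mathit{Body}$ with $l>1$, and let $\mathcal P^R$ be a partition (into nonempty sets) of the set of predicate symbols occurring in its head, where the equality symbol is included if it occurs there. For a member $\mathbf p$ of $\mathcal P^R$, $\mathit{shift}_{\mathbf p}(R)$ is the rule whose head is the disjunction of those $a_i$ whose predicate symbol is in $\mathbf p$, and whose body is $\mathit{Body}$ extended by $\mathit{not}\ a_j$ for every $a_j$ whose predicate symbol is not in $\mathbf p$. Let $\mathit{shift}_{\mathcal P^R}(R)=\{\mathit{shift}_{\mathbf p}(R):\mathbf p\in\mathcal P^R\}$. **Theorem.** Let $\Pi$ be a RASPL-1 program that contains at least one object constant, let $\mathbf R$ be a set of rules in $\Pi$ of the form $a_1\mid\dots\mid a_l\leftarrow\mathit{Body}$ with $l>1$, and for each $R\in\mathbf R$ let $\mathcal P^R$ be a partition as above. Suppose that for each $R\in\mathbf R$ there are no two distinct members $\mathbf p_1,\mathbf p_2$ of $\mathcal P^R$ and no strongly connected component $c$ of the dependency graph of $\Pi$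 with $c\cap\mathbf p_1\ne\emptyset$ and $c\cap\mathbf p_2\neq\emptyset$. Then the program obtained from $\Pi$ by replacing simultaneously each rule $R\in\mathbf R$ by the rules in $\mathit{shift}_{\mathcal P^R}(R)$ has the same answer sets as $\Pi$. -/

import Mathlib

namespace RASPL

universe u v w

/-! ### First-order formulas -/

/-- First-order formulas with terms over the function symbols of `L`, predicate symbols (or
predicate variables) `P k` of arity `k`, equality, and named variables from `W`.  The primitive
connectives are `⊥, ∧, ∨, →, ∀, ∃`. -/
inductive Fml (L : FirstOrder.Language.{u, v}) (P : ℕ → Type v) (W : Type w) : Type (max u v w)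
  | bot : Fml L P W
  | eq (s t : L.Term W) : Fml L P W
  | rel {k : ℕ} (p : P k) (ts : Fin k → L.Term W) : Fml L P W
  | and (F G : Fml L P W) : Fml L P W
  | or (F G : Fml L P W) : Fml L P W
  | imp (F G : Fml L P W) : Fml L P W
  | all (x : W) (F : Fml L P W) : Fml L P W
  | ex (x : W) (F : Fml L P W) : Fml L P W

/-- A predicate constant, together with its arity (equality is not among them). -/
abbrev PredConst (L : FirstOrder.Language.{u, v}) : Type v := Σ k, L.Relations k

/-- A function constant, together with its arity. -/
abbrev FunConst (L : FirstOrder.Language.{u, v}) : Type u := Σ k, L.Functions k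

/-- The function constants that occur in a term. -/
def termFuns {L : FirstOrder.Language.{u, v}} {W : Type w} : L.Term W → Set (FunConst L)
  | .var _ => ∅
  | .func f ts => {⟨_, f⟩} ∪ ⋃ i, termFuns (ts i)

namespace Fml

variable {L : FirstOrder.Language.{u, v}} {P : ℕ → Type v} {W : Type w}

/-- `¬F` is `F → ⊥`. -/
def neg (F : Fml L P W) : Fml L P W := .imp F .bot

/-- `⊤` is `⊥ → ⊥`. -/
def top : Fml L P W := .imp .bot .bot

/-- Conjunction of a list; the empty conjunction is `⊤`. -/
def conj : List (Fml L P W) → Fml L P W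
  | [] => top
  | [F] => F
  | F :: G :: l => .and F (conj (G :: l))

/-- Disjunction of a list; the empty disjunction is `⊥`. -/
def disj : List (Fml L P W) → Fml L P W
  | [] => .bot
  | [F] => F
  | F :: G :: l => .or F (disj (G :: l))

/-- `∃ x₁ ⋯ xₙ F`. -/
def exs (xs : List W) (F : Fml L P W) : Fml L P W := xs.foldr .ex F

open Classical in
/-- The variables that have a free occurrence in a formula. -/
noncomputable def freeVars : Fml L P W → Finset W
  | .bot => ∅
  | .eq s t => s.varFinset ∪ t.varFinset
  | .rel _ ts => Finset.univ.biUnion fun i => (ts i).varFinset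
  | .and F G => F.freeVars ∪ G.freeVars
  | .or F G => F.freeVars ∪ G.freeVars
  | .imp F G => F.freeVars ∪ G.freeVars
  | .all x F => F.freeVars.erase x
  | .ex x F => F.freeVars.erase x

/-- The universal closure. -/
noncomputable def closure (F : Fml L P W) : Fml L P W := F.freeVars.toList.foldr .all F

/-- The set of predicate constants, other than equality, that occur in a formula. -/
def preds : Fml L P W → Set (Σ k, P k)
  | .bot => ∅
  | .eq _ _ => ∅
  | .rel p _ => {⟨_, p⟩}
  | .and F G => F.preds ∪ G.preds
  | .or F G => F.preds ∪ G.preds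
  | .imp F G => F.preds ∪ G.preds
  | .all _ F => F.preds
  | .ex _ F => F.preds

/-- The set of function constants that occur in a formula. -/
def funs : Fml L P W → Set (FunConst L)
  | .bot => ∅
  | .eq s t => termFuns s ∪ termFuns t
  | .rel _ ts => ⋃ i, termFuns (ts i)
  | .and F G => F.funs ∪ G.funs
  | .or F G => F.funs ∪ G.funs
  | .imp F G => F.funs ∪ G.funs
  | .all _ F => F.funs
  | .ex _ F => F.funs

open Classical in
/-- Classical satisfaction in a universe `M`, where `r` interprets the predicate symbols (or
predicate variables) and `a` assigns values to the variables. -/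
def Sat {M : Type*} [L.Structure M] (r : ∀ k, P k → (Fin k → M) → Prop) :
    Fml L P W → (W → M) → Prop
  | .bot, _ => False
  | .eq s t, a => s.realize a = t.realize a
  | .rel p ts, a => r _ p fun i => (ts i).realize a
  | .and F G, a => F.Sat r a ∧ G.Sat r a
  | .or F G, a => F.Sat r a ∨ G.Sat r a
  | .imp F G, a => F.Sat r a → G.Sat r a
  | .all x F, a => ∀ m : M, F.Sat r (Function.update a x m)
  | .ex x F, a => ∃ m : M, F.Sat r (Function.update a x m)

/-! ### The operator SM -/

/-- Predicate symbols of the second-order language: `Sum.inl p` is the predicate variable `u_p`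
that corresponds to `p`, and `Sum.inr p` is the constant `p` itself. -/
abbrev WithVars (P : ℕ → Type v) : ℕ → Type v := fun k => P k ⊕ P k

/-- `F` itself, as a formula of the language with predicate variables. -/
def lift : Fml L P W → Fml L (WithVars P) W
  | .bot => .bot
  | .eq s t => .eq s t
  | .rel p ts => .rel (P := WithVars P) (Sum.inr p) ts
  | .and F G => .and F.lift G.lift
  | .or F G => .or F.lift G.lift
  | .imp F G => .imp F.lift G.lift
  | .all x F => .all x F.lift
  | .ex x F => .ex x F.lift

open Classical in
/-- The formula `F*(u)`, relative to the set `p` of intensional predicate symbols. -/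
noncomputable def star (p : Set (Σ k, P k)) : Fml L P W → Fml L (WithVars P) W
  | .bot => .bot
  | .eq s t => .eq s t
  | .rel q ts =>
      if (⟨_, q⟩ : Σ k, P k) ∈ p then .rel (P := WithVars P) (Sum.inl q) ts
      else .rel (P := WithVars P) (Sum.inr q) ts
  | .and F G => .and (F.star p) (G.star p)
  | .or F G => .or (F.star p) (G.star p)
  | .imp F G => .and (.imp (F.star p) (G.star p)) (.imp F.lift G.lift)
  | .all x F => .all x (F.star p)
  | .ex x F => .ex x (F.star p)

end Fml

section Stable

variable {L : FirstOrder.Language.{u, v}} {W : Type w}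

/-- `s ≤ r` for the members of `p`. -/
def PredLE {M : Type*} (p : Set (PredConst L)) (s r : ∀ k, L.Relations k → (Fin k → M) → Prop) :
    Prop :=
  ∀ q ∈ p, ∀ x : Fin q.1 → M, s q.1 q.2 x → r q.1 q.2 x

/-- `s < r` for the members of `p`. -/
def PredLT {M : Type*} (p : Set (PredConst L)) (s r : ∀ k, L.Relations k → (Fin k → M) → Prop) :
    Prop :=
  PredLE p s r ∧ ¬ PredLE p r s

/-- The structure `M` satisfies `SM_p[F] = F ∧ ¬∃u (u < p ∧ F*(u))`, i.e. it is a `p`-stable model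
of the sentence `F`.  Only the components of `u` with index in `p` matter. -/
def IsStableModel (M : Type*) [L.Structure M] (p : Set (PredConst L)) (F : Fml L L.Relations W) :
    Prop :=
  ∀ a : W → M,
    F.Sat (fun _ q => FirstOrder.Language.Structure.RelMap (M := M) q) a ∧
    ¬ ∃ s : ∀ k, L.Relations k → (Fin k → M) → Prop,
        PredLT p s (fun _ q => FirstOrder.Language.Structure.RelMap (M := M) q) ∧
        (F.star p).Sat
          (fun k => Sum.elim (s k) fun q => FirstOrder.Language.Structure.RelMap (M := M) q) a

/-! ### Herbrand interpretations and answer sets -/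

/-- The ground terms built from the function constants in `S`. -/
abbrev HerbrandUniverse (S : Set (FunConst L)) : Type u :=
  {t : L.Term Empty // termFuns t ⊆ S}

/-- A ground atom (not containing equality). -/
abbrev GroundAtom (L : FirstOrder.Language.{u, v}) : Type (max u v) :=
  Σ q : PredConst L, (Fin q.1 → L.Term Empty)

/-- `S` contains an object constant, i.e. a function constant of arity `0`. -/
def HasObjectConstant (S : Set (FunConst L)) : Prop :=
  ∃ c : L.Functions 0, (⟨0, c⟩ : FunConst L) ∈ S

/-- Some object constant of `S`, as an element of the Herbrand universe. -/
noncomputable def someConstant {S : Set (FunConst L)} (h : HasObjectConstant S) :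
    HerbrandUniverse S :=
  ⟨.func h.choose Fin.elim0, by
    intro f hf
    simp only [termFuns, Set.mem_union, Set.mem_singleton_iff, Set.mem_iUnion] at hf
    rcases hf with rfl | ⟨i, _⟩
    · exact h.choose_spec
    · exact i.elim0⟩

open Classical in
/-- The Herbrand interpretation of a signature with function constants `S` that is identified with
the set `X` of ground atoms: every ground term represents itself, and the true ground atoms are the
members of `X`.  Function constants outside the signature get an arbitrary value. -/
@[reducible] noncomputable def herbrandStructure (S : Set (FunConst L)) (h : HasObjectConstant S)
    (X : Set (GroundAtom L)) : L.Structure (HerbrandUniverse S) where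
  funMap {k} f ts :=
    if hf : (⟨k, f⟩ : FunConst L) ∈ S then
      ⟨.func f fun i => (ts i).1, by
        intro g hg
        simp only [termFuns, Set.mem_union, Set.mem_singleton_iff, Set.mem_iUnion] at hg
        rcases hg with rfl | ⟨i, hi⟩
        · exact hf
        · exact (ts i).2 hi⟩
    else someConstant h
  RelMap {k} q ts := (⟨⟨k, q⟩, fun i => (ts i).1⟩ : GroundAtom L) ∈ X

/-- `X`, a set of ground atoms, is an answer set of the sentence `F`: it is an Herbrand
interpretation of the signature of `F` (which contains an object constant) and a stable model of
`F` relative to all predicate constants that occur in `F`. -/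
def Fml.IsAnswerSet (F : Fml L L.Relations W) (X : Set (GroundAtom L)) : Prop :=
  (∀ A ∈ X, A.1 ∈ F.preds ∧ ∀ i, termFuns (A.2 i) ⊆ F.funs) ∧
  ∃ h : HasObjectConstant F.funs,
    letI := herbrandStructure F.funs h X
    IsStableModel (HerbrandUniverse F.funs) F.preds F

end Stable

/-! ### The dependency graph -/

namespace Fml

variable {L : FirstOrder.Language.{u, v}} {P : ℕ → Type v} {W : Type w}

/-- The predicate constants with a strictly positive occurrence in a formula. -/
def strictlyPos : Fml L P W → Set (Σ k, P k)
  | .bot => ∅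
  | .eq _ _ => ∅
  | .rel q _ => {⟨_, q⟩}
  | .and F G => F.strictlyPos ∪ G.strictlyPos
  | .or F G => F.strictlyPos ∪ G.strictlyPos
  | .imp _ G => G.strictlyPos
  | .all _ F => F.strictlyPos
  | .ex _ F => F.strictlyPos

/-- The predicate constants with a nonnegated occurrence in a formula that is positive (first
argument `true`), respectively not positive (first argument `false`).  An occurrence is positive if
the number of implications that contain it in the antecedent is even, and negated if it belongs to
a subformula of the form `G → ⊥`. -/
def nonnegated : Bool → Fml L P W → Set (Σ k, P k)
  | _, .bot => ∅
  | _, .eq _ _ => ∅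
  | b, .rel q _ => {x | b = true ∧ x = ⟨_, q⟩}
  | b, .and F G => nonnegated b F ∪ nonnegated b G
  | b, .or F G => nonnegated b F ∪ nonnegated b G
  | b, .imp F G => {x | G ≠ .bot ∧ (x ∈ nonnegated (!b) F ∨ x ∈ nonnegated b G)}
  | b, .all _ F => nonnegated b F
  | b, .ex _ F => nonnegated b F

/-- The FOL rules of a formula: the pairs `(G, H)` such that the implication `G → H` has a strictly
positive occurrence in it. -/
def folRules : Fml L P W → Set (Fml L P W × Fml L P W)
  | .bot => ∅
  | .eq _ _ => ∅
  | .rel _ _ => ∅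
  | .and F G => F.folRules ∪ G.folRules
  | .or F G => F.folRules ∪ G.folRules
  | .imp F G => {(F, G)} ∪ G.folRules
  | .all _ F => F.folRules
  | .ex _ F => F.folRules

/-- The predicate dependency graph of `F` relative to the set `p` of predicate constants. -/
def dependencyGraph (F : Fml L P W) (p : Set (Σ k, P k)) : Digraph p where
  Adj x y := ∃ R ∈ F.folRules, x.1 ∈ R.2.strictlyPos ∧ y.1 ∈ nonnegated true R.1

end Fml

/-- The (vertex sets of the) strongly connected components of a directed graph: the classes of
mutual reachability by directed paths, possibly of length zero. -/
def stronglyConnectedComponents {α : Type*} (G : Digraph α) : Set (Set α) :=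
  {c | ∃ x : α, c = {y | Relation.ReflTransGen G.Adj x y ∧ Relation.ReflTransGen G.Adj y x}}

/-! ### Syntax of programs -/

section Programs

variable (L : FirstOrder.Language.{u, v}) (V : Type w)

/-- An atom, possibly an equality `s = t`. -/
inductive Atom : Type (max u v w)
  | eq (s t : L.Term V) : Atom
  | rel {k : ℕ} (p : L.Relations k) (ts : Fin k → L.Term V) : Atom

/-- A predicate symbol: a predicate constant or the equality symbol. -/
inductive PredSym : Type v
  | equality : PredSym
  | const (p : PredConst L) : PredSym

/-- An atom, possibly preceded by `not`. -/
inductive Lit : Type (max u v w)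
  | pos (a : Atom L V) : Lit
  | not (a : Atom L V) : Lit

/-- The aggregate expression `bound ≤ #count{vars : lits}`. -/
structure Aggregate : Type (max u v w) where
  bound : ℕ+
  vars : List V
  lits : List (Lit L V)
  lits_ne_nil : lits ≠ []

/-- An element of a body: an atom or an aggregate expression. -/
inductive BodyElem : Type (max u v w)
  | atom (a : Atom L V) : BodyElem
  | agg (A : Aggregate L V) : BodyElem

/-- The body `e₁, …, eₘ, not eₘ₊₁, …, not eₙ`. -/
structure Body : Type (max u v w) where
  pos : List (BodyElem L V)
  neg : List (BodyElem L V)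

/-- The rule `a₁ | ⋯ | aₗ ← Body` (with `l ≥ 0`). -/
structure DisjRule : Type (max u v w) where
  head : List (Atom L V)
  body : Body L V

/-- A rule: `a₁ | ⋯ | aₗ ← Body` or the choice rule `{a} ← Body`. -/
inductive Rule : Type (max u v w)
  | disj (R : DisjRule L V) : Rule
  | choice (a : Atom L V) (body : Body L V) : Rule

/-- A program is a (finite) set of rules. -/
abbrev Program : Type (max u v w) := Finset (Rule L V)

noncomputable instance : DecidableEq (PredSym L) := Classical.decEq _
noncomputable instance : DecidableEq (Rule L V) := Classical.decEq _

end Programs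

/-! ### FOL representation

Variables of formulas are pairs in `V × ℕ`.  The pair `(x, 0)` stands for the variable `x` of the
program, and the pairs `(x, 1), (x, 2), …` are the new copies `x¹, x², …` of `x`. -/

section FOL

variable {L : FirstOrder.Language.{u, v}} {V : Type w}

/-- An atom, after the renaming `ρ` of variables. -/
def Atom.fol (ρ : V → V × ℕ) : Atom L V → Fml L L.Relations (V × ℕ)
  | .eq s t => .eq (s.relabel ρ) (t.relabel ρ)
  | .rel p ts => .rel p fun i => (ts i).relabel ρ

/-- A literal, after the renaming `ρ` of variables. -/
def Lit.fol (ρ : V → V × ℕ) : Lit L V → Fml L L.Relations (V × ℕ)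
  | .pos a => a.fol ρ
  | .not a => (a.fol ρ).neg

open Classical in
/-- The renaming of the variables in the list `xs` to their `i`-th copies. -/
noncomputable def copyVars (xs : List V) (i : ℕ) (x : V) : V × ℕ :=
  if x ∈ xs then (x, i) else (x, 0)

/-- `xⁱ = xʲ` for the `i`-th and the `j`-th copy of the list `xs`. -/
def copiesEq (L : FirstOrder.Language.{u, v}) (xs : List V) (i j : ℕ) : Fml L L.Relations (V × ℕ) :=
  .conj (xs.map fun x => .eq (.var (x, i)) (.var (x, j)))

/-- `∃ x¹ ⋯ xᵇ [⋀_{1 ≤ i ≤ b} F(xⁱ) ∧ ⋀_{1 ≤ i < j ≤ b} ¬(xⁱ = xʲ)]`. -/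
noncomputable def Aggregate.fol (A : Aggregate L V) : Fml L L.Relations (V × ℕ) :=
  let idx : List ℕ := List.range' 1 A.bound
  .exs (idx.flatMap fun i => A.vars.map fun x => (x, i))
    (.and
      (.conj (idx.map fun i => .conj (A.lits.map fun l => l.fol (copyVars A.vars i))))
      (.conj (idx.flatMap fun i =>
        (idx.filter fun j => i < j).map fun j => (copiesEq L A.vars i j).neg)))

/-- The FOL representation of an element of a body. -/
noncomputable def BodyElem.fol : BodyElem L V → Fml L L.Relations (V × ℕ)
  | .atom a => a.fol fun x => (x, 0)
  | .agg A => A.fol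

/-- The FOL representation of a body. -/
noncomputable def Body.fol (B : Body L V) : Fml L L.Relations (V × ℕ) :=
  .conj (B.pos.map BodyElem.fol ++ B.neg.map fun e => e.fol.neg)

/-- The FOL representation of a rule. -/
noncomputable def Rule.fol : Rule L V → Fml L L.Relations (V × ℕ)
  | .disj R => (Fml.imp R.body.fol (.disj (R.head.map (Atom.fol fun x => (x, 0))))).closure
  | .choice a B =>
      (Fml.imp (.and (a.fol fun x => (x, 0)).neg.neg B.fol) (a.fol fun x => (x, 0))).closure

/-- The FOL representation of a program: the conjunction of those of its rules. -/
noncomputable def Program.fol (prog : Program L V) : Fml L L.Relations (V × ℕ) :=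
  .conj (prog.toList.map Rule.fol)

/-- The answer sets of a program. -/
def Program.IsAnswerSet (prog : Program L V) (X : Set (GroundAtom L)) : Prop :=
  Fml.IsAnswerSet (Program.fol prog) X

/-- The dependency graph of a program; its vertices are the predicate constants that occur in the
program. -/
noncomputable def Program.dependencyGraph (prog : Program L V) :
    Digraph (Program.fol prog).preds :=
  (Program.fol prog).dependencyGraph (Program.fol prog).preds

/-! ### Shifting -/

/-- The predicate symbol `a⁰` of an atom `a`. -/
def Atom.pred : Atom L V → PredSym L
  | .eq _ _ => .equality
  | .rel p _ => .const ⟨_, p⟩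

/-- The set of the predicate symbols that occur in the head of a rule. -/
noncomputable def DisjRule.headPreds (R : DisjRule L V) : Finset (PredSym L) :=
  (R.head.map Atom.pred).toFinset

/-- `shift_p(R)`: the atoms of the head with predicate symbol in `p` stay in the head; every other
atom `a` of the head is moved to the body as `not a`. -/
noncomputable def DisjRule.shift (R : DisjRule L V) (p : Finset (PredSym L)) : DisjRule L V where
  head := R.head.filter fun a => a.pred ∈ p
  body :=
    { pos := R.body.pos
      neg := R.body.neg ++ (R.head.filter fun a => a.pred ∉ p).map BodyElem.atom }

/-- The set of the rules `shift_p(R)`, for all members `p` of the partition `part`. -/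
noncomputable def DisjRule.shiftPartition (R : DisjRule L V) (part : Finpartition R.headPreds) :
    Program L V :=
  part.parts.image fun p => .disj (R.shift p)

/-- The program obtained from `prog` when each rule `R` in `Rs` is replaced by the rules in
`shift_{part R}(R)`. -/
noncomputable def Program.replaceByShift (prog : Program L V) (Rs : Finset (DisjRule L V))
    (part : ∀ R : DisjRule L V, Finpartition R.headPreds) : Program L V :=
  (prog \ Rs.image Rule.disj) ∪ Rs.biUnion fun R => R.shiftPartition (part R)

end FOL

end RASPL

-- When every predicate symbol of `F` is intensional, `F*(u)` says that the pair (`s`, `r`), with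
-- `s` the value of `u` and `r` the given interpretation, satisfies `F` in the logic of
-- here-and-there (`sat_star_iff_ht`). An interpretation `r` is then stable when `r` satisfies `F`
-- and no pair (`s`, `r`) with `s` strictly below `r` does (`isStableModel_iff`).
--
-- In such a pair a negated atom is evaluated at `r` alone. Moving a head atom `A` into the body as
-- `not A` is therefore harmless if `s` and `r` agree on the predicate of `A`: either `A` holds at
-- `r`, hence also at `s`, and the original head is satisfied, or `not A` holds and the shifted rule
-- applies. So a rule is equivalent to its set of shifts on every pair whose components differ only
-- on constants that meet at most one member of the partition (`DisjRule.ht_fol_shift_iff`).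
--
-- By hypothesis, a strongly connected component is such a set of constants. It remains to see that
-- counterexamples to stability can be taken to differ from `r` inside a single component
-- (`Program.exists_ht_component`). Among the constants where `s` and `r` differ, choose one whose
-- component contains every such constant reachable from it, and reset `s` to `r` outside that
-- component. This applies to both programs with the graph of the original one, because shifting
-- adds only negated body atoms and so creates no edges (`DisjRule.dependenciesIn_shift`).

namespace RASPL

universe u v w

namespace Fml

variable {L : FirstOrder.Language.{u, v}} {P : ℕ → Type v} {W : Type w}
variable {M : Type*} [L.Structure M]

/-! ### Here-and-there satisfaction -/

/-- Satisfaction in the pair of interpretations `s` ("here") and `r` ("there"): this is the meaning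
of `F*(s)` when all predicate symbols of `F` are intensional. -/
def HT (s r : ∀ k, P k → (Fin k → M) → Prop) : Fml L P W → (W → M) → Prop
  | .bot, _ => False
  | .eq t t', a => t.realize a = t'.realize a
  | .rel p ts, a => s _ p fun i => (ts i).realize a
  | .and F G, a => F.HT s r a ∧ G.HT s r a
  | .or F G, a => F.HT s r a ∨ G.HT s r a
  | .imp F G, a => (F.HT s r a → G.HT s r a) ∧ (F.HT r r a → G.HT r r a)
  | .all x F, a => ∀ m : M, F.HT s r (by classical exact Function.update a x m)
  | .ex x F, a => ∃ m : M, F.HT s r (by classical exact Function.update a x m)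

theorem sat_iff_ht (r : ∀ k, P k → (Fin k → M) → Prop) (F : Fml L P W) (a : W → M) :
    F.Sat r a ↔ F.HT r r a := by
  induction F generalizing a with
  | bot | eq | rel => rfl
  | and F G hF hG | or F G hF hG | imp F G hF hG => simp [Sat, HT, hF, hG]
  | all x F hF | ex x F hF => simp [Sat, HT, hF]

theorem sat_lift (s r : ∀ k, P k → (Fin k → M) → Prop) (F : Fml L P W) (a : W → M) :
    F.lift.Sat (fun k => Sum.elim (s k) (r k)) a ↔ F.Sat r a := by
  induction F generalizing a with
  | bot | eq | rel => rfl
  | and F G hF hG | or F G hF hG | imp F G hF hG => simp [lift, Sat, hF, hG]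
  | all x F hF | ex x F hF => simp [lift, Sat, hF]

/-- The second conjunct of `(F → G)*` is the clause of `HT` at `r`. Since every atom of `F` is
starred, the predicate variables outside `p` are irrelevant, so `s'` and `s` need to agree only on
`p`. -/
theorem sat_star_iff_ht {p : Set (Σ k, P k)} {s s' r : ∀ k, P k → (Fin k → M) → Prop}
    {F : Fml L P W} (hF : F.preds ⊆ p) (hs : ∀ q ∈ p, s' q.1 q.2 = s q.1 q.2) (a : W → M) :
    (F.star p).Sat (fun k => Sum.elim (s' k) (r k)) a ↔ F.HT s r a := by
  induction F generalizing a with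
  | bot | eq => rfl
  | rel q ts =>
    have hq : (⟨_, q⟩ : Σ k, P k) ∈ p := hF rfl
    simp [star, hq, Sat, HT, hs _ hq]
  | and F G ihF ihG | or F G ihF ihG =>
    simp only [preds, Set.union_subset_iff] at hF
    simp [star, Sat, HT, ihF hF.1, ihG hF.2]
  | imp F G ihF ihG =>
    simp only [preds, Set.union_subset_iff] at hF
    simp only [star, Sat, HT, ihF hF.1, ihG hF.2, sat_lift]
    simp only [sat_iff_ht]
  | all x F ih | ex x F ih => simp [star, Sat, HT, ih hF]

/-- Persistence: atoms pass from `s` to the larger `r`, and the clause for implication contains its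
own value at `r`. -/
theorem HT.there {s r : ∀ k, P k → (Fin k → M) → Prop} (hs : s ≤ r) {F : Fml L P W} {a : W → M}
    (h : F.HT s r a) : F.HT r r a := by
  induction F generalizing a with
  | bot | eq => exact h
  | rel q ts => exact hs _ _ _ h
  | and F G ihF ihG => exact ⟨ihF h.1, ihG h.2⟩
  | or F G ihF ihG => exact h.imp ihF ihG
  | imp F G ihF ihG => exact ⟨h.2, h.2⟩
  | all x F ih => exact fun m => ih (h m)
  | ex x F ih => exact h.imp fun m => ih

theorem ht_neg {s r : ∀ k, P k → (Fin k → M) → Prop} (hs : s ≤ r) {F : Fml L P W} {a : W → M} :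
    F.neg.HT s r a ↔ ¬ F.HT r r a :=
  ⟨fun h => h.2, fun h => ⟨fun h' => h (h'.there hs), h⟩⟩

/-- Satisfaction is preserved from `t` to a smaller `s` that agrees with `t` on the positive
nonnegated predicate symbols, and from `s` to `t` if they agree on the other nonnegated ones. -/
theorem ht_of_agree_nonnegated {s t r : ∀ k, P k → (Fin k → M) → Prop} (hst : s ≤ t) (htr : t ≤ r)
    (F : Fml L P W) (a : W → M) :
    ((∀ q ∈ nonnegated true F, s q.1 q.2 = t q.1 q.2) → F.HT t r a → F.HT s r a) ∧
    ((∀ q ∈ nonnegated false F, s q.1 q.2 = t q.1 q.2) → F.HT s r a → F.HT t r a) := by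
  induction F generalizing a with
  | bot | eq => exact ⟨fun _ => id, fun _ => id⟩
  | rel q ts =>
    refine ⟨fun h h' => ?_, fun _ => hst _ _ _⟩
    have := h ⟨_, q⟩ ⟨rfl, rfl⟩
    simpa only [HT, this] using h'
  | and F G ihF ihG =>
    exact ⟨fun h h' => ⟨(ihF a).1 (fun q hq => h q (.inl hq)) h'.1,
        (ihG a).1 (fun q hq => h q (.inr hq)) h'.2⟩,
      fun h h' => ⟨(ihF a).2 (fun q hq => h q (.inl hq)) h'.1,
        (ihG a).2 (fun q hq => h q (.inr hq)) h'.2⟩⟩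
  | or F G ihF ihG =>
    exact ⟨fun h h' => h'.imp ((ihF a).1 fun q hq => h q (.inl hq))
        ((ihG a).1 fun q hq => h q (.inr hq)),
      fun h h' => h'.imp ((ihF a).2 fun q hq => h q (.inl hq))
        ((ihG a).2 fun q hq => h q (.inr hq))⟩
  | imp F G ihF ihG =>
    -- A negation depends on `r` only, so nothing is required of the symbols under it. In every
    -- other implication the antecedent reverses polarity, which is why both halves are proved by
    -- one induction.
    by_cases hG : G = .bot
    · subst hG
      exact ⟨fun _ h' => (ht_neg (hst.trans htr)).2 h'.2, fun _ h' => (ht_neg htr).2 h'.2⟩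
    · exact ⟨fun h h' => ⟨fun hF => (ihG a).1 (fun q hq => h q ⟨hG, .inr hq⟩)
          (h'.1 ((ihF a).2 (fun q hq => h q ⟨hG, .inl hq⟩) hF)), h'.2⟩,
        fun h h' => ⟨fun hF => (ihG a).2 (fun q hq => h q ⟨hG, .inr hq⟩)
          (h'.1 ((ihF a).1 (fun q hq => h q ⟨hG, .inl hq⟩) hF)), h'.2⟩⟩
  | all x F ih =>
    exact ⟨fun h h' m => (ih _).1 h (h' m), fun h h' m => (ih _).2 h (h' m)⟩
  | ex x F ih =>
    exact ⟨fun h h' => h'.imp fun m => (ih _).1 h, fun h h' => h'.imp fun m => (ih _).2 h⟩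

theorem ht_conj (s r : ∀ k, P k → (Fin k → M) → Prop) (l : List (Fml L P W)) (a : W → M) :
    (conj l).HT s r a ↔ ∀ F ∈ l, F.HT s r a := by
  induction l using conj.induct with
  | case1 => simp [conj, top, HT]
  | case2 F => simp [conj]
  | case3 F G l ih => rw [conj, HT, ih, List.forall_mem_cons (l := G :: l)]

theorem ht_disj (s r : ∀ k, P k → (Fin k → M) → Prop) (l : List (Fml L P W)) (a : W → M) :
    (disj l).HT s r a ↔ ∃ F ∈ l, F.HT s r a := by
  induction l using disj.induct with
  | case1 => simp [disj, HT]
  | case2 F => simp [disj]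
  | case3 F G l ih => rw [disj, HT, ih, List.exists_mem_cons_iff (l := G :: l)]

theorem ht_foldr_all (s r : ∀ k, P k → (Fin k → M) → Prop) (l : List W) (F : Fml L P W)
    (a : W → M) :
    (l.foldr .all F).HT s r a ↔ ∀ b : W → M, (∀ x ∉ l, b x = a x) → F.HT s r b := by
  induction l generalizing a with
  | nil =>
    simp only [List.foldr_nil, List.not_mem_nil, not_false_eq_true, forall_const]
    exact ⟨fun h b hb => funext hb ▸ h, fun h => h a fun _ => rfl⟩
  | cons x l ih =>
    simp only [List.foldr_cons, HT, ih]
    constructor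
    · intro h b hb
      refine h (b x) b fun y hy => ?_
      by_cases hyx : y = x
      · subst hyx; simp
      · simp [hyx, hb y (by simp [hy, hyx])]
    · intro h m b hb
      refine h b fun y hy => ?_
      simp only [List.mem_cons, not_or] at hy
      simp [hb y hy.2, hy.1]

/-- Ranging over whole assignments instead of iterated updates lets two closures with the same free
variables be compared one assignment at a time. -/
theorem ht_closure (s r : ∀ k, P k → (Fin k → M) → Prop) (F : Fml L P W) (a : W → M) :
    F.closure.HT s r a ↔ ∀ b : W → M, (∀ x ∉ F.freeVars, b x = a x) → F.HT s r b := by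
  simp [closure, ht_foldr_all]

/-! ### Symbols of conjunctions, disjunctions and closures -/

/-- A set of symbols that is collected from the immediate subformulas, for the propositional
connectives. -/
structure IsSymbolSet {α : Type*} (φ : Fml L P W → Set α) : Prop where
  bot : φ .bot = ∅
  and : ∀ F G, φ (.and F G) = φ F ∪ φ G
  or : ∀ F G, φ (.or F G) = φ F ∪ φ G
  imp : ∀ F G, φ (.imp F G) = φ F ∪ φ G

theorem isSymbolSet_preds : IsSymbolSet (preds : Fml L P W → _) :=
  ⟨rfl, fun _ _ => rfl, fun _ _ => rfl, fun _ _ => rfl⟩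

theorem isSymbolSet_funs : IsSymbolSet (funs : Fml L P W → _) :=
  ⟨rfl, fun _ _ => rfl, fun _ _ => rfl, fun _ _ => rfl⟩

theorem isSymbolSet_freeVars : IsSymbolSet fun F : Fml L P W => (F.freeVars : Set W) := by
  constructor <;> intros <;> simp [freeVars]

namespace IsSymbolSet

variable {α : Type*} {φ : Fml L P W → Set α} (h : IsSymbolSet φ)

include h

theorem neg (F : Fml L P W) : φ F.neg = φ F := by
  rw [Fml.neg, h.imp, h.bot, Set.union_empty]

theorem mem_conj (l : List (Fml L P W)) (x : α) : x ∈ φ (conj l) ↔ ∃ F ∈ l, x ∈ φ F := by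
  induction l using conj.induct with
  | case1 => simp [conj, top, h.imp, h.bot]
  | case2 F => simp [conj]
  | case3 F G l ih => rw [conj, h.and, Set.mem_union, ih, List.exists_mem_cons_iff (l := G :: l)]

theorem mem_disj (l : List (Fml L P W)) (x : α) : x ∈ φ (disj l) ↔ ∃ F ∈ l, x ∈ φ F := by
  induction l using disj.induct with
  | case1 => simp [disj, h.bot]
  | case2 F => simp [disj]
  | case3 F G l ih => rw [disj, h.or, Set.mem_union, ih, List.exists_mem_cons_iff (l := G :: l)]

end IsSymbolSet

theorem preds_closure (F : Fml L P W) : F.closure.preds = F.preds := by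
  unfold closure
  induction F.freeVars.toList with
  | nil => rfl
  | cons x l ih => exact ih

theorem funs_closure (F : Fml L P W) : F.closure.funs = F.funs := by
  unfold closure
  induction F.freeVars.toList with
  | nil => rfl
  | cons x l ih => exact ih

theorem folRules_closure (F : Fml L P W) : F.closure.folRules = F.folRules := by
  unfold closure
  induction F.freeVars.toList with
  | nil => rfl
  | cons x l ih => exact ih

theorem folRules_subset_conj {l : List (Fml L P W)} {F : Fml L P W} (hF : F ∈ l) :
    F.folRules ⊆ (conj l).folRules := by
  induction l using conj.induct with
  | case1 => simp at hF
  | case2 G => simp only [List.mem_singleton] at hF; rw [hF, conj]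
  | case3 G H l ih =>
    rcases List.mem_cons.1 hF with rfl | hF
    · exact Set.subset_union_left
    · exact (ih hF).trans Set.subset_union_right

theorem strictlyPos_subset_disj {l : List (Fml L P W)} {F : Fml L P W} (hF : F ∈ l) :
    F.strictlyPos ⊆ (disj l).strictlyPos := by
  induction l using disj.induct with
  | case1 => simp at hF
  | case2 G => simp only [List.mem_singleton] at hF; rw [hF, disj]
  | case3 G H l ih =>
    rcases List.mem_cons.1 hF with rfl | hF
    · exact Set.subset_union_left
    · exact (ih hF).trans Set.subset_union_right

theorem mem_nonnegated_conj (b : Bool) (l : List (Fml L P W)) (x : Σ k, P k) :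
    x ∈ nonnegated b (conj l) ↔ ∃ F ∈ l, x ∈ nonnegated b F := by
  induction l using conj.induct with
  | case1 => simp [conj, top, nonnegated]
  | case2 F => simp [conj]
  | case3 F G l ih => rw [conj, nonnegated, Set.mem_union, ih, List.exists_mem_cons_iff (l := G :: l)]

theorem finite_preds (F : Fml L P W) : F.preds.Finite := by
  induction F with
  | bot | eq => exact Set.finite_empty
  | rel => exact Set.finite_singleton _
  | and F G hF hG | or F G hF hG | imp F G hF hG => exact hF.union hG
  | all x F hF | ex x F hF => exact hF

end Fml

-- Stable models and answer sets in terms of here-and-there pairs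

section Stable

variable {L : FirstOrder.Language.{u, v}} {W : Type w}

theorem isStableModel_iff {M : Type*} [L.Structure M] {p : Set (PredConst L)}
    {F : Fml L L.Relations W} (hF : F.preds ⊆ p) {r : ∀ k, L.Relations k → (Fin k → M) → Prop}
    (hr : r = fun _ q => FirstOrder.Language.Structure.RelMap (M := M) q) :
    IsStableModel M p F ↔ ∀ a : W → M, F.HT r r a ∧
      ¬ ∃ s, s ≤ r ∧ s ≠ r ∧ (∀ q ∉ p, s q.1 q.2 = r q.1 q.2) ∧ F.HT s r a := by
  subst hr
  set r : ∀ k, L.Relations k → (Fin k → M) → Prop :=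
    fun _ q => FirstOrder.Language.Structure.RelMap (M := M) q with hr
  refine forall_congr' fun a => and_congr (Fml.sat_iff_ht r F a) (not_congr ⟨?_, ?_⟩)
  · rintro ⟨s, ⟨hle, hlt⟩, hs⟩
    -- Outside `p` the predicate variables are unconstrained; there `s` is replaced by `r`. On `p`
    -- the conjunction with `r` changes nothing, as `s` is already below `r`.
    refine ⟨fun k q x => (⟨k, q⟩ ∈ p → s k q x) ∧ r k q x, fun k q x h => h.2, ?_, ?_, ?_⟩
    · intro h
      refine hlt fun q hq x hx => ?_
      have h' : ((⟨q.1, q.2⟩ ∈ p → s q.1 q.2 x) ∧ r q.1 q.2 x) = r q.1 q.2 x :=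
        congrFun (congrFun (congrFun h q.1) q.2) x
      exact (h'.mpr hx).1 hq
    · intro q hq
      funext x
      simp [hq]
    · refine (Fml.sat_star_iff_ht hF (fun q hq => ?_) a).1 hs
      funext x
      simp only [hq, forall_const, eq_iff_iff]
      exact ⟨fun h => ⟨h, hle q hq x h⟩, fun h => h.1⟩
  · rintro ⟨s, hle, hne, hoff, hs⟩
    refine ⟨s, ⟨fun q _ => hle q.1 q.2, fun h => hne (le_antisymm hle fun k q => ?_)⟩,
      (Fml.sat_star_iff_ht hF (fun _ _ => rfl) a).2 hs⟩
    by_cases hq : (⟨k, q⟩ : PredConst L) ∈ p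
    · exact h _ hq
    · exact (hoff _ hq).ge

/-- The Herbrand universe is built from the function constants that occur in the formula, and the
intensional predicates are those that occur in it. Both sets must coincide before stability can be
compared in one structure. -/
theorem isAnswerSet_congr {F G : Fml L L.Relations W} (hfuns : F.funs = G.funs)
    (hpreds : F.preds = G.preds) (X : Set (GroundAtom L))
    (h : ∀ (M : Type u) [L.Structure M],
      IsStableModel M G.preds F ↔ IsStableModel M G.preds G) :
    F.IsAnswerSet X ↔ G.IsAnswerSet X := by
  unfold Fml.IsAnswerSet
  rw [hfuns, hpreds]
  exact and_congr_right fun _ => exists_congr fun _ => @h _ (_)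

end Stable

-- Reachability in finite directed graphs

/-- A nonempty set of vertices of a finite directed graph has a member whose strongly connected
component contains every member of the set that is reachable from it. -/
theorem exists_terminal_vertex {α : Type*} [Finite α] (G : Digraph α) {D : Set α}
    (hD : D.Nonempty) :
    ∃ x ∈ D, ∀ y ∈ D, Relation.ReflTransGen G.Adj x y → Relation.ReflTransGen G.Adj y x := by
  obtain ⟨x, hx, hmin⟩ := Set.exists_min_image D
    (fun x => {y | Relation.ReflTransGen G.Adj x y}.ncard) D.toFinite hD
  -- `x` reaches as few vertices as possible. What `y` reaches is contained in what `x` reaches, and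
  -- minimality forces equality; in particular `y` reaches `x`.
  refine ⟨x, hx, fun y hy hxy => ?_⟩
  have hsub : {z | Relation.ReflTransGen G.Adj y z} ⊆ {z | Relation.ReflTransGen G.Adj x z} :=
    fun z hz => hxy.trans hz
  have := Set.eq_of_subset_of_ncard_le hsub (hmin y hy) (Set.toFinite _)
  exact this.ge (Relation.ReflTransGen.refl (a := x))

-- Rules, their dependencies, and localization to one component

section Rules

variable {L : FirstOrder.Language.{u, v}} {V : Type w}

/-- The atoms in the head of a rule. -/
def Rule.headAtoms : Rule L V → List (Atom L V)
  | .disj R => R.head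
  | .choice a _ => [a]

/-- The antecedent of the FOL representation of a rule. -/
noncomputable def Rule.antecedent : Rule L V → Fml L L.Relations (V × ℕ)
  | .disj R => R.body.fol
  | .choice a B => .and (a.fol fun x => (x, 0)).neg.neg B.fol

theorem Rule.fol_eq (R : Rule L V) :
    R.fol = (Fml.imp R.antecedent
      (.disj (R.headAtoms.map (Atom.fol fun x => (x, 0))))).closure := by
  cases R <;> rfl

variable {M : Type*} [L.Structure M] {s t r : ∀ k, L.Relations k → (Fin k → M) → Prop}

/-- Monotonicity in the first component is special to atoms; it fails for implications. -/
theorem Atom.ht_mono (hst : s ≤ t) (A : Atom L V) (ρ : V → V × ℕ) (a : V × ℕ → M)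
    (h : (A.fol ρ).HT s r a) : (A.fol ρ).HT t r a := by
  cases A with
  | eq => exact h
  | rel => exact hst _ _ _ h

theorem Atom.ht_congr (A : Atom L V) (h : ∀ q, A.pred = .const q → s q.1 q.2 = t q.1 q.2)
    (ρ : V → V × ℕ) (a : V × ℕ → M) : (A.fol ρ).HT s r a ↔ (A.fol ρ).HT t r a := by
  cases A with
  | eq => rfl
  | rel p ts => simp only [Atom.fol, Fml.HT]; rw [h ⟨_, p⟩ rfl]

theorem Atom.mem_strictlyPos {A : Atom L V} {q : PredConst L} (h : A.pred = .const q)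
    (ρ : V → V × ℕ) : q ∈ (A.fol ρ).strictlyPos := by
  cases A with
  | eq => cases h
  | rel p ts => cases h; rfl

/-- Satisfaction of the implication between the antecedent and the head of a rule. -/
def Rule.HT (R : Rule L V) (s r : ∀ k, L.Relations k → (Fin k → M) → Prop) (a : V × ℕ → M) : Prop :=
  R.antecedent.HT s r a → ∃ A ∈ R.headAtoms, (A.fol fun x => (x, 0)).HT s r a

theorem Rule.ht_fol (R : Rule L V) (a : V × ℕ → M) :
    R.fol.HT s r a ↔ ∀ b : V × ℕ → M,
      (∀ x ∉ (Fml.imp R.antecedent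
        (.disj (R.headAtoms.map (Atom.fol fun x => (x, 0))))).freeVars, b x = a x) →
      R.HT s r b ∧ R.HT r r b := by
  simp [Rule.fol_eq, Fml.ht_closure, Fml.HT, Fml.ht_disj, Rule.HT]

theorem Program.ht_fol (prog : Program L V) (a : V × ℕ → M) :
    (Program.fol prog).HT s r a ↔ ∀ R ∈ prog, R.fol.HT s r a := by
  simp [Program.fol, Fml.ht_conj]

/-- The dependencies contributed by a rule are edges of the graph `G`. -/
def Rule.DependenciesIn {p : Set (PredConst L)} (R : Rule L V) (G : Digraph p) : Prop :=
  ∀ x y : p, (∃ A ∈ R.headAtoms, A.pred = .const x.1) →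
    y.1 ∈ Fml.nonnegated true R.antecedent → G.Adj x y

theorem Program.dependenciesIn {prog : Program L V} {R : Rule L V} (hR : R ∈ prog) :
    R.DependenciesIn (Program.dependencyGraph prog) := by
  rintro x y ⟨A, hA, hAx⟩ hy
  refine ⟨(R.antecedent, .disj (R.headAtoms.map (Atom.fol fun x => (x, 0)))), ?_, ?_, hy⟩
  · refine Fml.folRules_subset_conj
      (List.mem_map_of_mem (f := Rule.fol) (Finset.mem_toList.2 hR)) ?_
    rw [Rule.fol_eq, Fml.folRules_closure]
    exact Or.inl rfl
  · exact Fml.strictlyPos_subset_disj (List.mem_map_of_mem hA) (Atom.mem_strictlyPos hAx _)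

/-- If a program is satisfied by a pair of interpretations whose first component is strictly
smaller than the second one, then it is satisfied by such a pair where the components differ
within one strongly connected component only. -/
theorem Program.exists_ht_component {p : Set (PredConst L)} (hp : p.Finite) (G : Digraph p)
    (prog : Program L V) (hG : ∀ R ∈ prog, R.DependenciesIn G) {a : V × ℕ → M}
    (hsr : s ≤ r) (hne : s ≠ r) (hoff : ∀ q ∉ p, s q.1 q.2 = r q.1 q.2)
    (hs : (Program.fol prog).HT s r a) :
    ∃ c ∈ stronglyConnectedComponents G, ∃ t, t ≤ r ∧ t ≠ r ∧
      (∀ q : PredConst L, (∀ x ∈ c, x.1 ≠ q) → t q.1 q.2 = r q.1 q.2) ∧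
      (Program.fol prog).HT t r a := by
  have : Finite p := hp
  have hD : {q : p | s q.1.1 q.1.2 ≠ r q.1.1 q.1.2}.Nonempty := by
    by_contra h
    rw [Set.not_nonempty_iff_eq_empty, Set.eq_empty_iff_forall_notMem] at h
    refine hne (funext fun k => funext fun q => ?_)
    by_cases hq : (⟨k, q⟩ : PredConst L) ∈ p
    · exact not_not.1 (h ⟨_, hq⟩)
    · exact hoff _ hq
  obtain ⟨x, hx, hterm⟩ := exists_terminal_vertex G hD
  set c : Set p := {y | Relation.ReflTransGen G.Adj x y ∧ Relation.ReflTransGen G.Adj y x} with hc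
  -- `t` equals `s` on the component `c` and `r` everywhere else.
  let t : ∀ k, L.Relations k → (Fin k → M) → Prop :=
    fun k q m => ((∃ y ∈ c, y.1 = ⟨k, q⟩) → s k q m) ∧ r k q m
  have htc : ∀ y ∈ c, t y.1.1 y.1.2 = s y.1.1 y.1.2 := fun y hy => by
    funext m
    exact propext ⟨fun h => h.1 ⟨y, hy, rfl⟩, fun h => ⟨fun _ => h, hsr _ _ _ h⟩⟩
  have htoff : ∀ q : PredConst L, (∀ x ∈ c, x.1 ≠ q) → t q.1 q.2 = r q.1 q.2 := fun q hq => by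
    funext m
    exact propext ⟨fun h => h.2, fun h => ⟨fun ⟨y, hy, hyq⟩ => absurd hyq (hq y hy), h⟩⟩
  have htr : t ≤ r := fun k q m h => h.2
  have hst : s ≤ t := fun k q m h => ⟨fun _ => h, hsr _ _ _ h⟩
  refine ⟨c, ⟨x, rfl⟩, t, htr, fun h => hx ?_, htoff, ?_⟩
  · rw [← htc x ⟨.refl, .refl⟩, h]
  rw [Program.ht_fol] at hs ⊢
  intro R hR
  have hRs := hs R hR
  rw [Rule.ht_fol] at hRs ⊢
  intro b hb
  obtain ⟨h1, h2⟩ := hRs b hb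
  refine ⟨fun hbody => ?_, h2⟩
  -- If the head meets `c`, the body is carried down from `t` to `s` and the head atom obtained
  -- there is carried up again. Otherwise the body is carried up to `r`, and the resulting head atom
  -- has the same value at `t`.
  by_cases hhead : ∃ y ∈ c, ∃ A ∈ R.headAtoms, A.pred = .const y.1
  · obtain ⟨y, hy, hyR⟩ := hhead
    have hbody' : R.antecedent.HT s r b := by
      refine (Fml.ht_of_agree_nonnegated hst htr _ _).1 (fun q hq => ?_) hbody
      by_cases hqc : ∃ z ∈ c, z.1 = q
      · obtain ⟨z, hz, rfl⟩ := hqc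
        exact (htc z hz).symm
      · rw [htoff q fun z hz hzq => hqc ⟨z, hz, hzq⟩]
        by_cases hqp : q ∈ p
        -- A disagreement at `q` would make `q` reachable from `x` through the edge from `y`, so the
        -- choice of `x` would place `q` in `c`.
        · by_contra hqD
          have hxq : Relation.ReflTransGen G.Adj x ⟨q, hqp⟩ := hy.1.tail (hG R hR y ⟨q, hqp⟩ hyR hq)
          exact hqc ⟨⟨q, hqp⟩, ⟨hxq, hterm ⟨q, hqp⟩ hqD hxq⟩, rfl⟩
        · exact hoff q hqp
    obtain ⟨A, hA, h⟩ := h1 hbody'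
    exact ⟨A, hA, A.ht_mono hst _ _ h⟩
  · obtain ⟨A, hA, h⟩ := h2 (hbody.there htr)
    refine ⟨A, hA, (A.ht_congr (fun q hq => htoff q fun y hy hyq => ?_) _ _).2 h⟩
    exact hhead ⟨y, hy, A, hA, hyq ▸ hq⟩

end Rules

/-! ### Shifting -/

section Shift

variable {L : FirstOrder.Language.{u, v}} {V : Type w}

/-- Head atoms only change sides of the implication. This serves for predicates, functions and free
variables alike; the last keeps the universal closures aligned. -/
theorem DisjRule.symbols_shift {α : Type*} {φ : Fml L L.Relations (V × ℕ) → Set α}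
    (h : Fml.IsSymbolSet φ) (R : DisjRule L V) (p : Finset (PredSym L)) :
    φ (.imp (Rule.disj (R.shift p)).antecedent
        (.disj ((Rule.disj (R.shift p)).headAtoms.map (Atom.fol fun x => (x, 0))))) =
      φ (.imp (Rule.disj R).antecedent
        (.disj ((Rule.disj R).headAtoms.map (Atom.fol fun x => (x, 0))))) := by
  ext x
  simp only [Rule.antecedent, Rule.headAtoms, DisjRule.shift, Body.fol, h.imp, Set.mem_union,
    h.mem_conj, h.mem_disj, List.mem_append, or_and_right, exists_or, h.neg,
    List.mem_filter, decide_eq_true_eq, List.map_append, List.mem_map, exists_exists_and_eq_and,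
    BodyElem.fol, List.map_map, Function.comp]
  constructor
  · rintro ((h | h | ⟨A, hA, h⟩) | ⟨A, hA, h⟩)
    · exact .inl (.inl h)
    · exact .inl (.inr h)
    · exact .inr ⟨A, hA.1, h⟩
    · exact .inr ⟨A, hA.1, h⟩
  · rintro ((h | h) | ⟨A, hA, h⟩)
    · exact .inl (.inl h)
    · exact .inl (.inr (.inl h))
    · by_cases hp : A.pred ∈ p
      · exact .inr ⟨A, ⟨hA, hp⟩, h⟩
      · exact .inl (.inr (.inr ⟨A, ⟨hA, hp⟩, h⟩))

theorem DisjRule.preds_shift (R : DisjRule L V) (p : Finset (PredSym L)) :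
    (Rule.disj (R.shift p)).fol.preds = (Rule.disj R).fol.preds := by
  simp only [Rule.fol_eq, Fml.preds_closure]
  exact R.symbols_shift Fml.isSymbolSet_preds p

theorem DisjRule.funs_shift (R : DisjRule L V) (p : Finset (PredSym L)) :
    (Rule.disj (R.shift p)).fol.funs = (Rule.disj R).fol.funs := by
  simp only [Rule.fol_eq, Fml.funs_closure]
  exact R.symbols_shift Fml.isSymbolSet_funs p

/-- The head shrinks, and the new body elements are negated, hence without nonnegated occurrences.
-/
theorem DisjRule.dependenciesIn_shift {p : Set (PredConst L)} {G : Digraph p} {R : DisjRule L V}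
    (h : (Rule.disj R).DependenciesIn G) (q : Finset (PredSym L)) :
    (Rule.disj (R.shift q)).DependenciesIn G := by
  rintro x y ⟨A, hA, hAx⟩ hy
  refine h x y ⟨A, (List.mem_filter.1 hA).1, hAx⟩ ?_
  simp only [Rule.antecedent, DisjRule.shift, Body.fol, Fml.mem_nonnegated_conj,
    List.mem_append, List.map_append] at hy ⊢
  obtain ⟨F, hF | hF | hF, hy⟩ := hy
  · exact ⟨F, .inl hF, hy⟩
  · exact ⟨F, .inr hF, hy⟩
  · obtain ⟨e, -, rfl⟩ := List.mem_map.1 hF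
    simp [Fml.neg, Fml.nonnegated] at hy

variable {M : Type*} [L.Structure M] {s r : ∀ k, L.Relations k → (Fin k → M) → Prop}

theorem DisjRule.ht_antecedent_shift (hs : s ≤ r) (R : DisjRule L V) (p : Finset (PredSym L))
    (a : V × ℕ → M) :
    (Rule.disj (R.shift p)).antecedent.HT s r a ↔ (Rule.disj R).antecedent.HT s r a ∧
      ∀ A ∈ R.head, A.pred ∉ p → ¬ (A.fol fun x => (x, 0)).HT r r a := by
  simp only [Rule.antecedent, DisjRule.shift, Body.fol, Fml.ht_conj, List.map_append,
    List.mem_append, or_imp, forall_and, List.map_map, List.forall_mem_map, Function.comp,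
    BodyElem.fol, Fml.ht_neg hs, List.mem_filter, decide_eq_true_eq, and_imp, and_assoc]

/-- No agreement of `s` and `r` is needed here: the shifted body makes the removed head atoms false
at `r`, hence at `s`, so the true head atom is one that was kept. -/
theorem DisjRule.ht_shift (hs : s ≤ r) {R : DisjRule L V} {a : V × ℕ → M}
    (h : (Rule.disj R).HT s r a) (p : Finset (PredSym L)) :
    (Rule.disj (R.shift p)).HT s r a := by
  intro hbody
  obtain ⟨hbody, hneg⟩ := (R.ht_antecedent_shift hs p a).1 hbody
  obtain ⟨A, hA, hAs⟩ := h hbody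
  refine ⟨A, List.mem_filter.2 ⟨hA, ?_⟩, hAs⟩
  by_contra hp
  exact hneg A hA (by simpa using hp) (hAs.there hs)

/-- A removed head atom true at `r` is true at `s` by agreement and satisfies the original head; if
there is none, the shifted body holds. Equality has the same meaning at `s` and `r`, so only
constants enter the agreement condition. -/
theorem DisjRule.ht_of_shift (hs : s ≤ r) {R : DisjRule L V} {a : V × ℕ → M}
    {p : Finset (PredSym L)} (h : (Rule.disj (R.shift p)).HT s r a)
    (hp : ∀ q, .const q ∈ R.headPreds → .const q ∉ p → s q.1 q.2 = r q.1 q.2) :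
    (Rule.disj R).HT s r a := by
  intro hbody
  by_cases hneg : ∀ A ∈ R.head, A.pred ∉ p → ¬ (A.fol fun x => (x, 0)).HT r r a
  · obtain ⟨A, hA, hAs⟩ := h ((R.ht_antecedent_shift hs p a).2 ⟨hbody, hneg⟩)
    exact ⟨A, (List.mem_filter.1 hA).1, hAs⟩
  · push Not at hneg
    obtain ⟨A, hA, hAp, hAr⟩ := hneg
    refine ⟨A, hA, (A.ht_congr (fun q hq => hp q ?_ (hq ▸ hAp)) _ _).2 hAr⟩
    exact hq ▸ List.mem_toFinset.2 (List.mem_map_of_mem hA)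

theorem DisjRule.parts_nonempty {R : DisjRule L V} (hR : 1 < R.head.length)
    (P : Finpartition R.headPreds) : P.parts.Nonempty := by
  refine P.parts_nonempty ?_
  obtain ⟨A, hA⟩ := List.exists_mem_of_length_pos (Nat.zero_lt_of_lt hR)
  exact Finset.Nonempty.ne_empty ⟨A.pred, List.mem_toFinset.2 (List.mem_map_of_mem hA)⟩

/-- A rule is equivalent to its shifted rules if the interpretations differ only on a set of
predicate constants that meets at most one member of the partition. -/
theorem DisjRule.ht_fol_shift_iff (hs : s ≤ r) {c : Set (PredConst L)}
    (hc : ∀ q ∉ c, s q.1 q.2 = r q.1 q.2) {R : DisjRule L V} (hR : 1 < R.head.length)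
    (P : Finpartition R.headPreds)
    (hP : ∀ p₁ ∈ P.parts, ∀ p₂ ∈ P.parts, p₁ ≠ p₂ →
      ¬ ((∃ q ∈ c, .const q ∈ p₁) ∧ ∃ q ∈ c, .const q ∈ p₂)) (a : V × ℕ → M) :
    (∀ p ∈ P.parts, (Rule.disj (R.shift p)).fol.HT s r a) ↔ (Rule.disj R).fol.HT s r a := by
  have hfree (p : Finset (PredSym L)) := R.symbols_shift Fml.isSymbolSet_freeVars p
  simp only [Finset.coe_inj] at hfree
  simp only [Rule.ht_fol, hfree]
  constructor
  · intro h b hb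
    obtain ⟨p, hp, hpc⟩ : ∃ p ∈ P.parts, ∀ q : PredConst L, .const q ∈ R.headPreds → .const q ∉ p →
        s q.1 q.2 = r q.1 q.2 := by
      -- One shift suffices: the member of the partition that meets `c`, or any member if none does.
      -- Head constants outside it are not in `c`.
      by_cases hmeet : ∃ p ∈ P.parts, ∃ q ∈ c, .const q ∈ p
      · obtain ⟨p, hp, hpc⟩ := hmeet
        refine ⟨p, hp, fun q hq hqp => hc q fun hqc => ?_⟩
        obtain ⟨p', hp', hqp'⟩ := P.exists_mem hq
        exact hP p hp p' hp' (fun h => hqp (h ▸ hqp')) ⟨hpc, q, hqc, hqp'⟩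
      · obtain ⟨p, hp⟩ := R.parts_nonempty hR P
        refine ⟨p, hp, fun q hq _ => hc q fun hqc => ?_⟩
        obtain ⟨p', hp', hqp'⟩ := P.exists_mem hq
        exact hmeet ⟨p', hp', q, hqc, hqp'⟩
    exact ⟨DisjRule.ht_of_shift hs (h p hp b hb).1 hpc,
      DisjRule.ht_of_shift le_rfl (h p hp b hb).2 fun _ _ _ => rfl⟩
  · intro h p _ b hb
    exact ⟨DisjRule.ht_shift hs (h b hb).1 p, DisjRule.ht_shift le_rfl (h b hb).2 p⟩

theorem Program.mem_replaceByShift {prog : Program L V} {Rs : Finset (DisjRule L V)}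
    {part : ∀ R : DisjRule L V, Finpartition R.headPreds} {S : Rule L V} :
    S ∈ Program.replaceByShift prog Rs part ↔
      (S ∈ prog ∧ ∀ R ∈ Rs, Rule.disj R ≠ S) ∨
        ∃ R ∈ Rs, ∃ p ∈ (part R).parts, Rule.disj (R.shift p) = S := by
  simp [Program.replaceByShift, DisjRule.shiftPartition]

-- Shifting in a whole program

variable {prog : Program L V} {Rs : Finset (DisjRule L V)}
  {part : ∀ R : DisjRule L V, Finpartition R.headPreds}

theorem Program.symbols_replaceByShift {α : Type*} {φ : Fml L L.Relations (V × ℕ) → Set α}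
    (h : Fml.IsSymbolSet φ)
    (hshift : ∀ (R : DisjRule L V) p, φ (Rule.disj (R.shift p)).fol = φ (Rule.disj R).fol)
    (hRs : ∀ R ∈ Rs, Rule.disj R ∈ prog ∧ 1 < R.head.length) :
    φ (Program.fol (Program.replaceByShift prog Rs part)) = φ (Program.fol prog) := by
  ext x
  simp only [Program.fol, h.mem_conj, List.mem_map, exists_exists_and_eq_and, Finset.mem_toList]
  constructor
  · rintro ⟨S, hS, hx⟩
    obtain ⟨hS, -⟩ | ⟨R, hR, p, -, rfl⟩ := Program.mem_replaceByShift.1 hS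
    · exact ⟨S, hS, hx⟩
    · exact ⟨_, (hRs R hR).1, hshift R p ▸ hx⟩
  · rintro ⟨S, hS, hx⟩
    by_cases hSR : ∃ R ∈ Rs, Rule.disj R = S
    · obtain ⟨R, hR, rfl⟩ := hSR
      obtain ⟨p, hp⟩ := R.parts_nonempty (hRs R hR).2 (part R)
      exact ⟨_, Program.mem_replaceByShift.2 (.inr ⟨R, hR, p, hp, rfl⟩), (hshift R p).symm ▸ hx⟩
    · exact ⟨S, Program.mem_replaceByShift.2
        (.inl ⟨hS, fun R hR h => hSR ⟨R, hR, h⟩⟩), hx⟩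

theorem Program.ht_replaceByShift_iff (hs : s ≤ r) {c : Set (PredConst L)}
    (hc : ∀ q ∉ c, s q.1 q.2 = r q.1 q.2)
    (hRs : ∀ R ∈ Rs, Rule.disj R ∈ prog ∧ 1 < R.head.length)
    (hP : ∀ R ∈ Rs, ∀ p₁ ∈ (part R).parts, ∀ p₂ ∈ (part R).parts, p₁ ≠ p₂ →
      ¬ ((∃ q ∈ c, .const q ∈ p₁) ∧ ∃ q ∈ c, .const q ∈ p₂)) (a : V × ℕ → M) :
    (Program.fol (Program.replaceByShift prog Rs part)).HT s r a ↔
      (Program.fol prog).HT s r a := by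
  have key (R) (hR : R ∈ Rs) :=
    DisjRule.ht_fol_shift_iff hs hc (hRs R hR).2 (part R) (hP R hR) a
  simp only [Program.ht_fol]
  constructor
  · intro h S hS
    by_cases hSR : ∃ R ∈ Rs, Rule.disj R = S
    · obtain ⟨R, hR, rfl⟩ := hSR
      exact (key R hR).1 fun p hp =>
        h _ (Program.mem_replaceByShift.2 (.inr ⟨R, hR, p, hp, rfl⟩))
    · exact h S (Program.mem_replaceByShift.2 (.inl ⟨hS, fun R hR h => hSR ⟨R, hR, h⟩⟩))
  · intro h S hS
    obtain ⟨hS, -⟩ | ⟨R, hR, p, hp, rfl⟩ := Program.mem_replaceByShift.1 hS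
    · exact h S hS
    · exact (key R hR).2 (h _ (hRs R hR).1) p hp

theorem Program.dependenciesIn_replaceByShift
    (hRs : ∀ R ∈ Rs, Rule.disj R ∈ prog ∧ 1 < R.head.length) :
    ∀ S ∈ Program.replaceByShift prog Rs part,
      S.DependenciesIn (Program.dependencyGraph prog) := by
  intro S hS
  obtain ⟨hS, -⟩ | ⟨R, hR, p, -, rfl⟩ := Program.mem_replaceByShift.1 hS
  · exact Program.dependenciesIn hS
  · exact DisjRule.dependenciesIn_shift (Program.dependenciesIn (hRs R hR).1) p

theorem Program.isStableModel_replaceByShift_iff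
    (hRs : ∀ R ∈ Rs, Rule.disj R ∈ prog ∧ 1 < R.head.length)
    (hpart : ∀ R ∈ Rs, ∀ p₁ ∈ (part R).parts, ∀ p₂ ∈ (part R).parts, p₁ ≠ p₂ →
      ¬ ∃ c ∈ stronglyConnectedComponents (Program.dependencyGraph prog),
        (∃ q ∈ c, PredSym.const q.1 ∈ p₁) ∧ (∃ q ∈ c, PredSym.const q.1 ∈ p₂)) :
    IsStableModel M (Program.fol prog).preds
        (Program.fol (Program.replaceByShift prog Rs part)) ↔
      IsStableModel M (Program.fol prog).preds (Program.fol prog) := by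
  have hpreds := Program.symbols_replaceByShift (part := part) Fml.isSymbolSet_preds
    DisjRule.preds_shift hRs
  rw [isStableModel_iff hpreds.subset rfl, isStableModel_iff subset_rfl rfl]
  refine forall_congr' fun a => and_congr ?_ (not_congr ?_)
  -- Classical satisfaction is the case of equal components, which differ on the empty set.
  · exact Program.ht_replaceByShift_iff (c := ∅) le_rfl (fun _ _ => rfl) hRs (by simp) a
  set r : ∀ k, L.Relations k → (Fin k → M) → Prop :=
    fun _ q => FirstOrder.Language.Structure.RelMap (M := M) q
  -- On pairs that differ only within one component, both programs are satisfied or neither is; a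
  -- localized counterexample to stability thus passes in either direction.
  have hcomp {c : Set (Program.fol prog).preds}
      (hc : c ∈ stronglyConnectedComponents (Program.dependencyGraph prog))
      {t : ∀ k, L.Relations k → (Fin k → M) → Prop} (htr : t ≤ r)
      (ht : ∀ q : PredConst L, (∀ x ∈ c, x.1 ≠ q) → t q.1 q.2 = r q.1 q.2) :=
    Program.ht_replaceByShift_iff (part := part) (c := Subtype.val '' c) htr
      (fun q hq => ht q fun x hx hxq => hq ⟨x, hx, hxq⟩) hRs (fun R hR p₁ h₁ p₂ h₂ hne h =>
        hpart R hR p₁ h₁ p₂ h₂ hne ⟨c, hc, by simpa using h⟩) a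
  have hoff' {c : Set (Program.fol prog).preds} {t : ∀ k, L.Relations k → (Fin k → M) → Prop}
      (ht : ∀ q : PredConst L, (∀ x ∈ c, x.1 ≠ q) → t q.1 q.2 = r q.1 q.2)
      (q : PredConst L) (hq : q ∉ (Program.fol prog).preds) : t q.1 q.2 = r q.1 q.2 :=
    ht q fun x _ hxq => hq (hxq ▸ x.2)
  constructor
  · rintro ⟨s, hsr, hne, hoff, hs⟩
    obtain ⟨c, hc, t, htr, htne, ht, h⟩ := Program.exists_ht_component (Fml.finite_preds _)
      (Program.dependencyGraph prog) _ (Program.dependenciesIn_replaceByShift hRs) hsr hne hoff hs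
    exact ⟨t, htr, htne, hoff' ht, (hcomp hc htr ht).1 h⟩
  · rintro ⟨s, hsr, hne, hoff, hs⟩
    obtain ⟨c, hc, t, htr, htne, ht, h⟩ := Program.exists_ht_component (Fml.finite_preds _)
      (Program.dependencyGraph prog) _ (fun R => Program.dependenciesIn) hsr hne hoff hs
    exact ⟨t, htr, htne, hoff' ht, (hcomp hc htr ht).2 h⟩

end Shift

end RASPL

theorem mainTheorem4 {L : FirstOrder.Language} {V : Type*}
    (prog : RASPL.Program L V)
    (hprog : RASPL.HasObjectConstant (RASPL.Program.fol prog).funs)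
    (Rs : Finset (RASPL.DisjRule L V))
    (hRs : ∀ R ∈ Rs, RASPL.Rule.disj R ∈ prog ∧ 1 < R.head.length)
    (part : ∀ R : RASPL.DisjRule L V, Finpartition R.headPreds)
    (hpart : ∀ R ∈ Rs, ∀ p₁ ∈ (part R).parts, ∀ p₂ ∈ (part R).parts, p₁ ≠ p₂ →
      ¬ ∃ c ∈ RASPL.stronglyConnectedComponents (RASPL.Program.dependencyGraph prog),
        (∃ q ∈ c, RASPL.PredSym.const q.1 ∈ p₁) ∧ (∃ q ∈ c, RASPL.PredSym.const q.1 ∈ p₂)) :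
    ∀ X : Set (RASPL.GroundAtom L),
      RASPL.Program.IsAnswerSet (RASPL.Program.replaceByShift prog Rs part) X ↔
        RASPL.Program.IsAnswerSet prog X := by
  intro X
  exact RASPL.isAnswerSet_congr
    (RASPL.Program.symbols_replaceByShift RASPL.Fml.isSymbolSet_funs RASPL.DisjRule.funs_shift hRs)
    (RASPL.Program.symbols_replaceByShift RASPL.Fml.isSymbolSet_preds RASPL.DisjRule.preds_shift hRs)
    X fun M _ => RASPL.Program.isStableModel_replaceByShift_iff hRs hpart
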